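/- All rings are commutative with $1$. A \emph{$ba\ell$-algebra} is a lattice-ordered $\mathbb R$-algebra $A$ that is bounded (for each $a\in A$ there is an integer $n\ge 1$ with $a\le n\cdot 1$) and archimedean (if $n\cdot a\le b$ for all $n\ge 1$, then $a\le 0$); a \emph{$ba\ell$-isomorphism} is an isomorphism of unital $\mathbb R$-algebras that preserves binary joins and meets. An \emph{$\ell$-ideal} of $A$ is an ideal $I$ such that $|a|\le |b|$ and $b\in I$ imply $a\in I$; it is \emph{archimedean} if the quotient $A/I$ is archimedean. Let $X$ be the set of proper archimedean $\ell$-ideals of $A$, ordered by inclusion and equipped with the Alexandroff topology, whose open sets are the up-sets. Let $Y_A\subseteq X$ be the set of maximal $\ell$-ideals of $A$ (each of which is archimedean). For a set $S$, let $B(S)$ be the $ba\ell$-algebra of all bounded functions $S\to\mathbb R$ with pointwise operations and order. For $f\in B(X)$ put $$f_*(x)=\sup\{\inf f[U]\mid U \text{ an open neighbourhood of } x\},\qquad f^*(x)=\inf\{\sup f[U]\mid U \text{ an open neighbourhood of } x\},$$ $f^\#=(f^*)_*$, and $N(X)=\{f\in B(X)\mid f=f^\#\}$. \textbf{Theorem}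 (assuming the axiom of choice). Let $A$ be a $ba\ell$-algebra, and let $X$ and $Y_A$ be as above. Then $N(X)$, with the pointwise order and with operations the normalizations of those of $B(X)$ (so that, for example, the sum of $f$ and $g$ in $N(X)$ is $(f+g)^\#$), is a $ba\ell$-algebra, and there is a $ba\ell$-isomorphism $\psi:N(X)\to B(Y_A)$ such that $\psi(f)=f|_{Y_A}$ is the restriction of $f$ to $Y_A$ for every $f\in N(X)$. Moreover, for every $f\in B(X)$ and every $I\in X$, $$f^\#(I)=\inf\{f(M)\mid M\in Y_A,\ I\subseteq M\}.$$ -/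

import Mathlib

/-- Bounded archimedean `ℓ`-algebras: commutative unital `ℝ`-algebras with a lattice order
compatible with the algebra operations, in which `1` is a strong order unit and which are
archimedean. -/
class BalAlgebra (A : Type*) extends CommRing A, Lattice A, Algebra ℝ A where
  protected add_le_add_left' : ∀ a b : A, a ≤ b → ∀ c : A, c + a ≤ c + b
  protected mul_nonneg' : ∀ a b : A, 0 ≤ a → 0 ≤ b → 0 ≤ a * b
  protected smul_nonneg' : ∀ (r : ℝ) (a : A), 0 ≤ r → 0 ≤ a → 0 ≤ r • a
  protected bounded' : ∀ a : A, ∃ n : ℕ, 1 ≤ n ∧ a ≤ n • (1 : A)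
  protected archimedean' : ∀ a b : A, (∀ n : ℕ, 1 ≤ n → n • a ≤ b) → a ≤ 0

/-- Isomorphisms of bounded archimedean `ℓ`-algebras: isomorphisms of unital `ℝ`-algebras
preserving binary joins and meets. -/
structure BalEquiv (A B : Type*) [BalAlgebra A] [BalAlgebra B] extends A ≃ₐ[ℝ] B where
  map_sup : ∀ a b : A, toFun (a ⊔ b) = toFun a ⊔ toFun b
  map_inf : ∀ a b : A, toFun (a ⊓ b) = toFun a ⊓ toFun b

section Ideals

variable {A : Type*} [BalAlgebra A]

/-- `ℓ`-ideals: ring ideals `I` such that `|a| ≤ |b|` and `b ∈ I` imply `a ∈ I`. -/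
def IsLIdeal (I : Ideal A) : Prop :=
  ∀ a b : A, |a| ≤ |b| → b ∈ I → a ∈ I

/-- The order of the quotient `A ⧸ I` by an `ℓ`-ideal. -/
def quotientLE (I : Ideal A) (x y : A ⧸ I) : Prop :=
  ∃ a b : A, Ideal.Quotient.mk I a = x ∧ Ideal.Quotient.mk I b = y ∧ a ≤ b

/-- Archimedean `ℓ`-ideals: the `ℓ`-ideals `I` such that `A ⧸ I` is archimedean. -/
def IsArchLIdeal (I : Ideal A) : Prop :=
  IsLIdeal I ∧
    ∀ x y : A ⧸ I, (∀ n : ℕ, 1 ≤ n → quotientLE I (n • x) y) → quotientLE I x 0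

/-- Maximal `ℓ`-ideals: maximal elements among the proper `ℓ`-ideals. -/
def IsMaxLIdeal (M : Ideal A) : Prop :=
  Maximal (fun I : Ideal A => IsLIdeal I ∧ I ≠ ⊤) M

end Ideals

/-- The set of proper archimedean `ℓ`-ideals of `A`. -/
structure ProperArch (A : Type*) [BalAlgebra A] where
  ideal : Ideal A
  isArch : IsArchLIdeal ideal
  ne_top : ideal ≠ ⊤

/-- Proper archimedean `ℓ`-ideals are ordered by inclusion. -/
instance (A : Type*) [BalAlgebra A] : PartialOrder (ProperArch A) :=
  PartialOrder.lift ProperArch.ideal (fun I J h => by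
    cases I; cases J; cases h; rfl)

/-- The Alexandroff topology: the open sets are the up-sets. -/
instance (A : Type*) [BalAlgebra A] : TopologicalSpace (ProperArch A) :=
  Topology.upperSet (ProperArch A)

/-- The set of maximal `ℓ`-ideals of `A`. -/
structure MaxLIdeal (A : Type*) [BalAlgebra A] where
  ideal : Ideal A
  isMax : IsMaxLIdeal ideal

section MaximalAreArchimedean

variable {A : Type*} [BalAlgebra A]

instance BalAlgebra.isOrderedAddMonoid : IsOrderedAddMonoid A where
  add_le_add_left a b h c := by
    rw [add_comm a c, add_comm b c]; exact BalAlgebra.add_le_add_left' a b h c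

theorem BalAlgebra.nonneg_of_nsmul {n : ℕ} (hn : 1 ≤ n) {a : A} (h : 0 ≤ n • a) : 0 ≤ a := by
  have h1 := BalAlgebra.smul_nonneg' ((n : ℝ)⁻¹) (n • a) (by positivity) h
  have hn' : (n : ℝ) ≠ 0 := by positivity
  rwa [← Nat.cast_smul_eq_nsmul ℝ n a, smul_smul, inv_mul_cancel₀ hn', one_smul] at h1

theorem BalAlgebra.one_nonneg : (0 : A) ≤ 1 := by
  obtain ⟨n, -, h⟩ := BalAlgebra.bounded' (-1 : A)
  refine BalAlgebra.nonneg_of_nsmul (n := n + 1) (by omega) ?_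
  rw [succ_nsmul]
  have := add_le_add_left h 1
  simpa using this

theorem BalAlgebra.abs_mul_le_nsmul (c x y : A) {m : ℕ} (hc : |c| ≤ m • (1 : A)) (hx : |x| ≤ y) :
    |c * x| ≤ m • y := by
  obtain ⟨c1, c2⟩ := abs_le'.1 hc
  obtain ⟨x1, x2⟩ := abs_le'.1 hx
  have p1 : 0 ≤ m • (1 : A) - c := sub_nonneg.2 c1
  have p2 : 0 ≤ m • (1 : A) + c := by simpa using sub_nonneg.2 c2
  have q1 : 0 ≤ y - x := sub_nonneg.2 x1
  have q2 : 0 ≤ y + x := by simpa using sub_nonneg.2 x2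
  have r1 := add_nonneg (BalAlgebra.mul_nonneg' _ _ p1 q2) (BalAlgebra.mul_nonneg' _ _ p2 q1)
  have r2 := add_nonneg (BalAlgebra.mul_nonneg' _ _ p1 q1) (BalAlgebra.mul_nonneg' _ _ p2 q2)
  refine abs_le'.2 ⟨?_, ?_⟩ <;> rw [← sub_nonneg] <;>
    refine BalAlgebra.nonneg_of_nsmul (n := 2) (by norm_num) ?_
  · convert r1 using 1
    simp only [nsmul_eq_mul]; push_cast; ring
  · convert r2 using 1
    simp only [nsmul_eq_mul]; push_cast; ring

/-- The `ℓ`-ideal generated by an `ℓ`-ideal `M` and an element `p`. -/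
def lIdealAdjoin (M : Ideal A) (p : A) : Ideal A where
  carrier := {x | ∃ k : ℕ, ∃ i ∈ M, |x| ≤ k • p + i}
  zero_mem' := ⟨0, 0, M.zero_mem, by simp⟩
  add_mem' := by
    rintro x y ⟨k, i, hi, hx⟩ ⟨l, j, hj, hy⟩
    refine ⟨k + l, i + j, M.add_mem hi hj, (abs_add_le x y).trans ?_⟩
    refine (add_le_add hx hy).trans (le_of_eq ?_)
    rw [add_nsmul]; abel
  smul_mem' := by
    rintro c x ⟨k, i, hi, hx⟩
    obtain ⟨m, -, hm⟩ := BalAlgebra.bounded' |c|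
    refine ⟨m * k, m • i, M.nsmul_mem hi m, ?_⟩
    have := BalAlgebra.abs_mul_le_nsmul c x _ hm hx
    rwa [nsmul_add, ← mul_nsmul'] at this

/-- Every maximal `ℓ`-ideal is archimedean. -/
theorem IsMaxLIdeal.isArchLIdeal {M : Ideal A} (hM : IsMaxLIdeal M) : IsArchLIdeal M := by
  obtain ⟨⟨hL, hne⟩, hmax⟩ := hM
  refine ⟨hL, fun x y h => ?_⟩
  obtain ⟨a, rfl⟩ := Ideal.Quotient.mk_surjective x
  obtain ⟨b, rfl⟩ := Ideal.Quotient.mk_surjective y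
  have hone : (1 : A) ∉ M := fun h1 => hne ((Ideal.eq_top_iff_one M).2 h1)
  have habs : ∀ i ∈ M, |i| ∈ M := fun i hi => hL _ i (by rw [abs_abs]) hi
  have key : a ⊔ 0 ∈ M := by
    by_contra hp
    set p := a ⊔ 0 with hpdef
    have hp0 : (0 : A) ≤ p := le_sup_right
    set J := lIdealAdjoin M p
    have hMJ : M ≤ J := fun i hi => ⟨0, |i|, habs i hi, by simp⟩
    have hpJ : p ∈ J := ⟨1, 0, M.zero_mem, by simp [abs_of_nonneg hp0]⟩
    have hJL : IsLIdeal J := by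
      rintro u v huv ⟨k, i, hi, hv⟩
      exact ⟨k, i, hi, huv.trans hv⟩
    have hJtop : J = ⊤ := by
      by_contra hJ
      exact hp (hmax ⟨hJL, hJ⟩ hMJ hpJ)
    have h1 : (1 : A) ∈ J := by rw [hJtop]; trivial
    obtain ⟨k, i, hi, hk⟩ := h1
    rw [abs_of_nonneg BalAlgebra.one_nonneg] at hk
    obtain ⟨m, hm, hb⟩ := BalAlgebra.bounded' b
    obtain ⟨u, v, hu, hv, huv⟩ := h (2 * m * k + 1) (by omega)
    rw [← map_nsmul] at hu
    have hu' := Ideal.Quotient.eq.1 hu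
    have hv' := Ideal.Quotient.eq.1 hv
    set n := 2 * m * k + 1 with hn
    set j := |u - n • a| + |v - b| with hj
    have hjM : j ∈ M := M.add_mem (habs _ hu') (habs _ hv')
    have hj0 : 0 ≤ j := add_nonneg (abs_nonneg _) (abs_nonneg _)
    have hm1 : (0 : A) ≤ m • (1 : A) := nsmul_nonneg BalAlgebra.one_nonneg m
    have hna : n • a ≤ m • (1 : A) + j := by
      have e1 : n • a ≤ u + |u - n • a| := by
        have := neg_le_abs (u - n • a)
        have := add_le_add_right this u
        simpa using this
      have e2 : v ≤ b + |v - b| := by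
        have := add_le_add_right (le_abs_self (v - b)) b
        simpa using this
      calc n • a ≤ u + |u - n • a| := e1
        _ ≤ (m • (1 : A) + |v - b|) + |u - n • a| := by
            gcongr
            exact huv.trans (e2.trans (by gcongr))
        _ = m • (1 : A) + j := by rw [hj]; abel
    -- passing from `a` to its positive part
    have hnp : n • p ≤ m • (1 : A) + j := by
      have hq : a ≤ ((n : ℝ)⁻¹) • (m • (1 : A) + j) := by
        have := BalAlgebra.smul_nonneg' ((n : ℝ)⁻¹) _ (by positivity) (sub_nonneg.2 hna)
        have hn' : (n : ℝ) ≠ 0 := by rw [hn]; positivity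
        rw [smul_sub, ← Nat.cast_smul_eq_nsmul ℝ n a, smul_smul, inv_mul_cancel₀ hn',
          one_smul] at this
        exact sub_nonneg.1 this
      have hp' : p ≤ ((n : ℝ)⁻¹) • (m • (1 : A) + j) :=
        sup_le hq (BalAlgebra.smul_nonneg' _ _ (by positivity) (add_nonneg hm1 hj0))
      have hn' : (n : ℝ) ≠ 0 := by rw [hn]; positivity
      have := nsmul_le_nsmul_right hp' n
      rwa [← Nat.cast_smul_eq_nsmul ℝ n (((n : ℝ)⁻¹) • _), smul_smul, mul_inv_cancel₀ hn',
        one_smul] at this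
    have hkp : (2 * m) • (1 : A) ≤ (2 * m * k) • p + (2 * m) • i := by
      have := nsmul_le_nsmul_right hk (2 * m)
      rwa [nsmul_add, ← mul_nsmul'] at this
    have hle : (2 * m * k) • p ≤ n • p := nsmul_le_nsmul_left hp0 (by omega)
    have hfin : m • (1 : A) ≤ j + (2 * m) • i := by
      have h3 : (2 * m) • (1 : A) ≤ (m • (1 : A) + j) + (2 * m) • i :=
        hkp.trans (by gcongr; exact hle.trans hnp)
      rw [two_mul, add_nsmul, add_assoc] at h3
      have := le_of_add_le_add_left h3
      rwa [two_mul]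
    have h1le : (1 : A) ≤ j + (2 * m) • i := by
      refine le_trans ?_ hfin
      simpa using nsmul_le_nsmul_left (BalAlgebra.one_nonneg (A := A)) hm
    refine hone (hL 1 (j + (2 * m) • i) ?_ (M.add_mem hjM (M.nsmul_mem hi _)))
    rw [abs_of_nonneg BalAlgebra.one_nonneg]
    exact h1le.trans (le_abs_self _)
  refine ⟨a - (a ⊔ 0), 0, ?_, map_zero _, sub_nonpos.2 le_sup_left⟩
  rw [map_sub, Ideal.Quotient.eq_zero_iff_mem.2 key, sub_zero]

/-- The inclusion of the maximal `ℓ`-ideals into the proper archimedean `ℓ`-ideals. -/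
def MaxLIdeal.toProperArch (M : MaxLIdeal A) : ProperArch A where
  ideal := M.ideal
  isArch := M.isMax.isArchLIdeal
  ne_top := M.isMax.prop.2

end MaximalAreArchimedean

/-- The bounded real-valued functions on `X`, as a subalgebra of all functions. -/
def boundedSubalgebra (X : Type*) : Subalgebra ℝ (X → ℝ) where
  carrier := {f | ∃ C : ℝ, ∀ x, |f x| ≤ C}
  add_mem' := by
    rintro f g ⟨C, hC⟩ ⟨D, hD⟩
    exact ⟨C + D, fun x => (abs_add_le _ _).trans (add_le_add (hC x) (hD x))⟩
  mul_mem' := by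
    rintro f g ⟨C, hC⟩ ⟨D, hD⟩
    refine ⟨C * D, fun x => ?_⟩
    rw [Pi.mul_apply, abs_mul]
    exact mul_le_mul (hC x) (hD x) (abs_nonneg _) ((abs_nonneg _).trans (hC x))
  algebraMap_mem' r := ⟨|r|, fun _ => le_rfl⟩

/-- `B(X)`: the algebra of bounded real-valued functions on `X`. -/
abbrev BddFun (X : Type*) : Type _ := boundedSubalgebra X

/-- The lattice operations of `B(X)` are pointwise. -/
instance (X : Type*) : Lattice (BddFun X) :=
  Subtype.lattice
    (P := fun f => f ∈ boundedSubalgebra X)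
    (by
      rintro f g ⟨C, hC⟩ ⟨D, hD⟩
      refine ⟨max C D, fun x => ?_⟩
      exact abs_max_le_max_abs_abs.trans (max_le_max (hC x) (hD x)))
    (by
      rintro f g ⟨C, hC⟩ ⟨D, hD⟩
      refine ⟨max C D, fun x => ?_⟩
      exact abs_min_le_max_abs_abs.trans (max_le_max (hC x) (hD x)))

instance (X : Type*) : BalAlgebra (BddFun X) where
  add_le_add_left' f g h k x := by
    have := h x
    simpa using this
  mul_nonneg' f g hf hg x := mul_nonneg (hf x) (hg x)
  smul_nonneg' r f hr hf x := mul_nonneg hr (hf x)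
  bounded' := by
    rintro ⟨f, C, hC⟩
    obtain ⟨n, hn⟩ := exists_nat_ge C
    refine ⟨n + 1, by omega, fun x => ?_⟩
    have h1 : f x ≤ (n : ℝ) + 1 := by linarith [hC x, le_abs_self (f x)]
    simpa using h1
  archimedean' f g h x := by
    by_contra hx
    have hx' : 0 < f.1 x := not_le.1 hx
    obtain ⟨n, hn⟩ := exists_nat_gt (g.1 x / f.1 x)
    have h1 : ((n + 1 : ℕ) : ℝ) * f.1 x ≤ g.1 x := by
      have := h (n + 1) (by omega) x
      simpa using this
    rw [div_lt_iff₀ hx'] at hn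
    push_cast at h1
    linarith

section Normal

variable {X : Type*} [TopologicalSpace X]

/-- `f_* (x) = sup { inf f[U] | U an open neighbourhood of x }`. -/
noncomputable def lowerEnvelope (f : BddFun X) : BddFun X :=
  ⟨fun x => sSup {r : ℝ | ∃ U : Set X, IsOpen U ∧ x ∈ U ∧ r = sInf (f.1 '' U)}, by
    obtain ⟨f, C, hC⟩ := f
    refine ⟨C, fun x => abs_le.2 ?_⟩
    have hb : ∀ r ∈ {r : ℝ | ∃ U : Set X, IsOpen U ∧ x ∈ U ∧ r = sInf (f '' U)},
        -C ≤ r ∧ r ≤ C := by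
      rintro r ⟨U, -, hx, rfl⟩
      have hlb : ∀ s ∈ f '' U, -C ≤ s := by
        rintro _ ⟨y, -, rfl⟩; exact (abs_le.1 (hC y)).1
      exact ⟨le_csInf ⟨_, x, hx, rfl⟩ hlb,
        (csInf_le ⟨-C, hlb⟩ ⟨x, hx, rfl⟩).trans (abs_le.1 (hC x)).2⟩
    have hne : {r : ℝ | ∃ U : Set X, IsOpen U ∧ x ∈ U ∧ r = sInf (f '' U)}.Nonempty :=
      ⟨_, Set.univ, isOpen_univ, trivial, rfl⟩
    refine ⟨?_, csSup_le hne fun r hr => (hb r hr).2⟩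
    obtain ⟨r, hr⟩ := hne
    exact (hb r hr).1.trans (le_csSup ⟨C, fun r hr => (hb r hr).2⟩ hr)⟩

/-- `f^* (x) = inf { sup f[U] | U an open neighbourhood of x }`. -/
noncomputable def upperEnvelope (f : BddFun X) : BddFun X :=
  ⟨fun x => sInf {r : ℝ | ∃ U : Set X, IsOpen U ∧ x ∈ U ∧ r = sSup (f.1 '' U)}, by
    obtain ⟨f, C, hC⟩ := f
    refine ⟨C, fun x => abs_le.2 ?_⟩
    have hb : ∀ r ∈ {r : ℝ | ∃ U : Set X, IsOpen U ∧ x ∈ U ∧ r = sSup (f '' U)},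
        -C ≤ r ∧ r ≤ C := by
      rintro r ⟨U, -, hx, rfl⟩
      have hub : ∀ s ∈ f '' U, s ≤ C := by
        rintro _ ⟨y, -, rfl⟩; exact (abs_le.1 (hC y)).2
      exact ⟨(abs_le.1 (hC x)).1.trans (le_csSup ⟨C, hub⟩ ⟨x, hx, rfl⟩),
        csSup_le ⟨_, x, hx, rfl⟩ hub⟩
    have hne : {r : ℝ | ∃ U : Set X, IsOpen U ∧ x ∈ U ∧ r = sSup (f '' U)}.Nonempty :=
      ⟨_, Set.univ, isOpen_univ, trivial, rfl⟩
    refine ⟨le_csInf hne fun r hr => (hb r hr).1, ?_⟩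
    obtain ⟨r, hr⟩ := hne
    exact (csInf_le ⟨-C, fun r hr => (hb r hr).1⟩ hr).trans (hb r hr).2⟩

/-- The normalization `f^# = (f^*)_*` of a bounded function. -/
noncomputable def normalization (f : BddFun X) : BddFun X :=
  lowerEnvelope (upperEnvelope f)

end Normal

/-- `N(X)`: the set of bounded normal functions, `f = f^#`. -/
structure NormalFun (X : Type*) [TopologicalSpace X] where
  val : BddFun X
  normal : val = normalization val

/-- A bounded archimedean `ℓ`-algebra structure on `N(X)` is the standard one when its order is
pointwise and its operations are the normalizations of the pointwise operations of `B(X)`. -/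
structure IsNormalizedStructure (X : Type*) [TopologicalSpace X] [BalAlgebra (NormalFun X)] :
    Prop where
  le_iff : ∀ f g : NormalFun X, f ≤ g ↔ f.val ≤ g.val
  sup_val : ∀ f g : NormalFun X, (f ⊔ g).val = normalization (f.val ⊔ g.val)
  inf_val : ∀ f g : NormalFun X, (f ⊓ g).val = normalization (f.val ⊓ g.val)
  zero_val : (0 : NormalFun X).val = normalization 0
  one_val : (1 : NormalFun X).val = normalization 1
  add_val : ∀ f g : NormalFun X, (f + g).val = normalization (f.val + g.val)
  neg_val : ∀ f : NormalFun X, (-f).val = normalization (-f.val)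
  mul_val : ∀ f g : NormalFun X, (f * g).val = normalization (f.val * g.val)
  smul_val : ∀ (r : ℝ) (f : NormalFun X), (r • f).val = normalization (r • f.val)

/-- The restriction of a bounded function on proper archimedean `ℓ`-ideals to the maximal
`ℓ`-ideals. -/
def restrictMax {A : Type*} [BalAlgebra A] (f : BddFun (ProperArch A)) : BddFun (MaxLIdeal A) :=
  ⟨fun M => f.1 M.toProperArch, f.2.imp fun _ hC M => hC M.toProperArch⟩

/-! The maximal `ℓ`-ideals form a dense set of isolated points of `X`: each `M` is a maximal element
of `X`, so `{M}` is an up-set, and by Zorn's lemma every `I` in `X` lies below some `M`. In an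
Alexandroff topology the envelopes at `x` are the extrema over the elements above `x`. Hence `f^*`
agrees with `f` at every `M`, while `f^*(J) ≥ f(M)` whenever `J ⊆ M`. The infimum of `f^*` over the
elements above `I` is therefore already the infimum of `f` over the maximal `M ⊇ I`, which is
`isGLB_normalization`.

So `f^#` depends only on the restriction of `f` to `Y_A` and has that same restriction. Restriction
`N(X) → B(Y_A)` is thus a bijection, whose inverse normalizes an arbitrary bounded extension
(`restrictEquiv`). The structure of `B(Y_A)` is transported along it. The transported operations are
the normalized ones because restriction commutes with pointwise operations and all extensions of a
function have the same normalization (`restrictEquiv_symm_val`). -/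

/-! ### Maximal `ℓ`-ideals above a given ideal -/

section Zorn

variable {A : Type*} [BalAlgebra A]

/-- The union of a nonempty chain of proper `ℓ`-ideals is a proper `ℓ`-ideal. -/
theorem isLIdeal_sSup_of_isChain {c : Set (Ideal A)} (hc : ∀ I ∈ c, IsLIdeal I ∧ I ≠ ⊤)
    (hchain : IsChain (· ≤ ·) c) (hne : c.Nonempty) :
    IsLIdeal (sSup c) ∧ sSup c ≠ ⊤ := by
  have hmem (a : A) : a ∈ sSup c ↔ ∃ I ∈ c, a ∈ I :=
    Submodule.mem_sSup_of_directed hne hchain.directedOn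
  constructor
  · intro a b hab hb
    obtain ⟨I, hI, hbI⟩ := (hmem b).1 hb
    exact (hmem a).2 ⟨I, hI, (hc I hI).1 a b hab hbI⟩
  -- Properness survives the union because it is the absence of `1`, which would already lie in a
  -- member of the chain.
  · intro htop
    obtain ⟨I, hI, h1⟩ := (hmem 1).1 (htop ▸ Submodule.mem_top)
    exact (hc I hI).2 ((Ideal.eq_top_iff_one I).2 h1)

/-- Every proper `ℓ`-ideal is contained in a maximal `ℓ`-ideal. -/
theorem IsLIdeal.exists_le_isMaxLIdeal {I : Ideal A} (hI : IsLIdeal I) (hne : I ≠ ⊤) :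
    ∃ M : Ideal A, I ≤ M ∧ IsMaxLIdeal M :=
  zorn_le_nonempty₀ {J : Ideal A | IsLIdeal J ∧ J ≠ ⊤}
    (fun c hc hchain J hJ => ⟨sSup c, isLIdeal_sSup_of_isChain hc hchain ⟨J, hJ⟩,
      fun _ hK => le_sSup hK⟩) I ⟨hI, hne⟩

theorem ProperArch.exists_le_toProperArch (I : ProperArch A) :
    ∃ M : MaxLIdeal A, I ≤ M.toProperArch :=
  let ⟨M, hIM, hM⟩ := I.isArch.1.exists_le_isMaxLIdeal I.ne_top
  ⟨⟨M, hM⟩, hIM⟩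

/-- Maximality among all proper `ℓ`-ideals is inherited by the smaller family of archimedean ones.
-/
theorem MaxLIdeal.isMax_toProperArch (M : MaxLIdeal A) : IsMax M.toProperArch :=
  fun J hJ => M.isMax.2 ⟨J.isArch.1, J.ne_top⟩ hJ

theorem MaxLIdeal.toProperArch_injective :
    Function.Injective (MaxLIdeal.toProperArch : MaxLIdeal A → ProperArch A) := by
  rintro ⟨M⟩ ⟨N⟩ h
  cases congrArg ProperArch.ideal h
  rfl

end Zorn

theorem BddFun.bddAbove_image {X : Type*} (f : BddFun X) (s : Set X) : BddAbove (f.1 '' s) := by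
  obtain ⟨C, hC⟩ := f.2
  exact ⟨C, by rintro _ ⟨y, -, rfl⟩; exact (abs_le.1 (hC y)).2⟩

theorem BddFun.bddBelow_image {X : Type*} (f : BddFun X) (s : Set X) : BddBelow (f.1 '' s) := by
  obtain ⟨C, hC⟩ := f.2
  exact ⟨-C, by rintro _ ⟨y, -, rfl⟩; exact (abs_le.1 (hC y)).1⟩

/-! ### Envelopes in an Alexandroff topology -/

section UpperSetTopology

variable {X : Type*} [Preorder X] [TopologicalSpace X] [Topology.IsUpperSet X]

/-- In the Alexandroff topology, `f_* (x)` is the infimum of `f` over the elements above `x`. -/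
theorem isGLB_lowerEnvelope (f : BddFun X) (x : X) :
    IsGLB (f.1 '' Set.Ici x) ((lowerEnvelope f).1 x) := by
  have hne : (f.1 '' Set.Ici x).Nonempty := ⟨_, x, Set.self_mem_Ici, rfl⟩
  -- `Set.Ici x` is the least open neighbourhood of `x`, so the supremum over neighbourhoods is
  -- attained there.
  have hgr : IsGreatest {r : ℝ | ∃ U : Set X, IsOpen U ∧ x ∈ U ∧ r = sInf (f.1 '' U)}
      (sInf (f.1 '' Set.Ici x)) := by
    refine ⟨⟨_, Topology.IsUpperSet.isOpen_iff_isUpperSet.2 (isUpperSet_Ici x),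
      Set.self_mem_Ici, rfl⟩, ?_⟩
    rintro _ ⟨U, hU, hx, rfl⟩
    exact csInf_le_csInf (f.bddBelow_image U) hne (Set.image_mono
      ((Topology.IsUpperSet.isOpen_iff_isUpperSet.1 hU).Ici_subset hx))
  change IsGLB _ (sSup _)
  rw [hgr.csSup_eq]
  exact isGLB_csInf hne (f.bddBelow_image _)

/-- In the Alexandroff topology, `f^* (x)` is the supremum of `f` over the elements above `x`. -/
theorem isLUB_upperEnvelope (f : BddFun X) (x : X) :
    IsLUB (f.1 '' Set.Ici x) ((upperEnvelope f).1 x) := by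
  have hne : (f.1 '' Set.Ici x).Nonempty := ⟨_, x, Set.self_mem_Ici, rfl⟩
  have hle : IsLeast {r : ℝ | ∃ U : Set X, IsOpen U ∧ x ∈ U ∧ r = sSup (f.1 '' U)}
      (sSup (f.1 '' Set.Ici x)) := by
    refine ⟨⟨_, Topology.IsUpperSet.isOpen_iff_isUpperSet.2 (isUpperSet_Ici x),
      Set.self_mem_Ici, rfl⟩, ?_⟩
    rintro _ ⟨U, hU, hx, rfl⟩
    exact csSup_le_csSup (f.bddAbove_image U) hne (Set.image_mono
      ((Topology.IsUpperSet.isOpen_iff_isUpperSet.1 hU).Ici_subset hx))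
  change IsLUB _ (sInf _)
  rw [hle.csInf_eq]
  exact isLUB_csSup hne (f.bddAbove_image _)

theorem upperEnvelope_apply_of_forall_eq (f : BddFun X) {m : X} (hm : ∀ y, m ≤ y → y = m) :
    (upperEnvelope f).1 m = f.1 m := by
  have hIci : Set.Ici m = {m} := Set.eq_singleton_iff_unique_mem.2 ⟨Set.self_mem_Ici, hm⟩
  have h := isLUB_upperEnvelope f m
  rw [hIci, Set.image_singleton] at h
  exact h.unique isLUB_singleton

end UpperSetTopology

/-! ### Normalization and restriction to the maximal `ℓ`-ideals -/

section Normalization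

variable {A : Type*} [BalAlgebra A]

instance (A : Type*) [BalAlgebra A] : Topology.IsUpperSet (ProperArch A) := ⟨rfl⟩

/-- The normalization of `f` at `I` is the infimum of `f` over the maximal `ℓ`-ideals
containing `I`. -/
theorem isGLB_normalization (f : BddFun (ProperArch A)) (I : ProperArch A) :
    IsGLB {r : ℝ | ∃ M : MaxLIdeal A, I ≤ M.toProperArch ∧ r = f.1 M.toProperArch}
      ((normalization f).1 I) := by
  have h := isGLB_lowerEnvelope (upperEnvelope f) I
  constructor
  · rintro _ ⟨M, hM, rfl⟩
    -- Since `f(M) = f^*(M)`, this value is among those whose infimum is taken.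
    rw [← upperEnvelope_apply_of_forall_eq f fun _ hJ => (M.isMax_toProperArch.eq_of_le hJ).symm]
    exact h.1 ⟨_, hM, rfl⟩
  · refine fun r hr => h.2 ?_
    rintro _ ⟨J, hJ, rfl⟩
    -- A single `M` above `J` suffices, as `f^*(J) ≥ f(M)`.
    obtain ⟨M, hM⟩ := J.exists_le_toProperArch
    exact (hr ⟨M, le_trans hJ hM, rfl⟩).trans ((isLUB_upperEnvelope f J).1 ⟨_, hM, rfl⟩)

theorem normalization_mono_of_restrictMax_le {f g : BddFun (ProperArch A)}
    (h : restrictMax f ≤ restrictMax g) : normalization f ≤ normalization g := by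
  intro I
  refine (isGLB_normalization g I).2 ?_
  rintro _ ⟨M, hM, rfl⟩
  exact ((isGLB_normalization f I).1 ⟨M, hM, rfl⟩).trans (h M)

theorem normalization_congr {f g : BddFun (ProperArch A)} (h : restrictMax f = restrictMax g) :
    normalization f = normalization g :=
  (normalization_mono_of_restrictMax_le h.le).antisymm
    (normalization_mono_of_restrictMax_le h.ge)

/-- The only maximal `ℓ`-ideal containing `M` is `M` itself, so the infimum at `M` is over one
value. -/
theorem restrictMax_normalization (f : BddFun (ProperArch A)) :
    restrictMax (normalization f) = restrictMax f := by
  refine Subtype.ext (funext fun M => ?_)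
  refine (isGLB_normalization f M.toProperArch).unique (IsLeast.isGLB ⟨⟨M, le_rfl, rfl⟩, ?_⟩)
  rintro _ ⟨N, hN, rfl⟩
  exact (congrArg f.1 (M.isMax_toProperArch.eq_of_le hN)).le

/-- The normalization of a bounded function, as an element of `N(X)`. -/
noncomputable def NormalFun.ofBddFun (f : BddFun (ProperArch A)) : NormalFun (ProperArch A) :=
  ⟨normalization f, normalization_congr (restrictMax_normalization f).symm⟩

/-- Extension by zero of a bounded function on the maximal `ℓ`-ideals. -/
noncomputable def extendByZero (g : BddFun (MaxLIdeal A)) : BddFun (ProperArch A) :=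
  ⟨Function.extend MaxLIdeal.toProperArch g.1 0, by
    obtain ⟨C, hC⟩ := g.2
    -- The `0` bounds the value off the maximal `ℓ`-ideals, without needing `0 ≤ C`.
    refine ⟨max C 0, fun I => ?_⟩
    by_cases hI : ∃ M : MaxLIdeal A, M.toProperArch = I
    · obtain ⟨M, rfl⟩ := hI
      rw [MaxLIdeal.toProperArch_injective.extend_apply]
      exact (hC M).trans (le_max_left _ _)
    · rw [Function.extend_apply' _ _ _ hI]
      simp⟩

theorem restrictMax_extendByZero (g : BddFun (MaxLIdeal A)) :
    restrictMax (extendByZero g) = g :=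
  Subtype.ext (funext fun M => MaxLIdeal.toProperArch_injective.extend_apply g.1 0 M)

/-- Restriction to the maximal `ℓ`-ideals is a bijection from the normal functions on `X` to the
bounded functions on the maximal `ℓ`-ideals. -/
noncomputable def restrictEquiv (A : Type*) [BalAlgebra A] :
    NormalFun (ProperArch A) ≃ BddFun (MaxLIdeal A) where
  toFun f := restrictMax f.val
  invFun g := NormalFun.ofBddFun (extendByZero g)
  left_inv := by
    rintro ⟨f, hf⟩
    -- The extension by zero may differ from `f`, but both restrict alike and so share the
    -- normalization, which is `f`.
    have h : normalization (extendByZero (restrictMax f)) = f :=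
      (normalization_congr (restrictMax_extendByZero _)).trans hf.symm
    simp only [NormalFun.ofBddFun, h]
  right_inv g := (restrictMax_normalization _).trans (restrictMax_extendByZero g)

/-- The choice of extension is immaterial; taking for `h` a pointwise operation on `X` identifies
the transported operation with the normalized one. -/
theorem restrictEquiv_symm_val {g : BddFun (MaxLIdeal A)} {h : BddFun (ProperArch A)}
    (hgh : restrictMax h = g) : ((restrictEquiv A).symm g).val = normalization h :=
  normalization_congr ((restrictMax_extendByZero g).trans hgh.symm)

theorem restrictMax_le_iff {f g : NormalFun (ProperArch A)} :
    restrictMax f.val ≤ restrictMax g.val ↔ f.val ≤ g.val := by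
  refine ⟨fun h => ?_, fun h M => h M.toProperArch⟩
  rw [f.normal, g.normal]
  exact normalization_mono_of_restrictMax_le h

end Normalization

/-! ### Transport of structure along a bijection -/

section Transfer

variable {S B : Type*} [BalAlgebra B]

/-- Transfer of a lattice structure along a bijection. -/
abbrev latticeOfEquiv (e : S ≃ B) : Lattice S where
  le a b := e a ≤ e b
  le_refl _ := le_refl _
  le_trans _ _ _ := le_trans
  le_antisymm _ _ h h' := e.injective (le_antisymm h h')
  sup a b := e.symm (e a ⊔ e b)
  inf a b := e.symm (e a ⊓ e b)
  le_sup_left a b := by simp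
  le_sup_right a b := by simp
  sup_le a b c h h' := by simpa using And.intro h h'
  inf_le_left a b := by simp
  inf_le_right a b := by simp
  le_inf a b c h h' := by simpa using And.intro h h'

/-- Transfer of the structure of a bounded archimedean `ℓ`-algebra along a bijection. -/
noncomputable abbrev BalAlgebra.ofEquiv (e : S ≃ B) : BalAlgebra S :=
  letI : CommRing S := e.commRing
  letI : Algebra ℝ S := e.algebra ℝ
  letI : Lattice S := latticeOfEquiv e
  have hle (a b : S) : a ≤ b ↔ e a ≤ e b := Iff.rfl
  have hadd (a b : S) : e (a + b) = e a + e b := map_add e.ringEquiv a b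
  have hmul (a b : S) : e (a * b) = e a * e b := map_mul e.ringEquiv a b
  have hzero : e 0 = 0 := map_zero e.ringEquiv
  have hone : e 1 = 1 := map_one e.ringEquiv
  have hnsmul (n : ℕ) (a : S) : e (n • a) = n • e a := map_nsmul e.ringEquiv n a
  have hsmul (r : ℝ) (a : S) : e (r • a) = r • e a := map_smul (e.algEquiv ℝ) r a
  { (inferInstance : CommRing S), (inferInstance : Lattice S),
    (inferInstance : Algebra ℝ S) with
    add_le_add_left' a b h c := by
      rw [hle, hadd, hadd]
      exact BalAlgebra.add_le_add_left' _ _ h _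
    mul_nonneg' a b ha hb := by
      rw [hle, hzero] at ha hb ⊢
      rw [hmul]
      exact BalAlgebra.mul_nonneg' _ _ ha hb
    smul_nonneg' r a hr ha := by
      rw [hle, hzero] at ha ⊢
      rw [hsmul]
      exact BalAlgebra.smul_nonneg' _ _ hr ha
    bounded' a := by
      obtain ⟨n, hn, h⟩ := BalAlgebra.bounded' (e a)
      refine ⟨n, hn, ?_⟩
      rwa [hle, hnsmul, hone]
    archimedean' a b h := by
      rw [hle, hzero]
      refine BalAlgebra.archimedean' (e a) (e b) fun n hn => ?_
      rw [← hnsmul, ← hle]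
      exact h n hn }

/-- The bijection along which the structure is transferred is an isomorphism. -/
noncomputable def BalEquiv.ofEquiv (e : S ≃ B) :
    letI := BalAlgebra.ofEquiv e
    BalEquiv S B :=
  letI := BalAlgebra.ofEquiv e
  { e.algEquiv ℝ with
    map_sup _ _ := e.apply_symm_apply _
    map_inf _ _ := e.apply_symm_apply _ }

end Transfer

theorem mainTheorem5 (A : Type*) [BalAlgebra A] :
    (∃ _ : BalAlgebra (NormalFun (ProperArch A)),
      IsNormalizedStructure (ProperArch A) ∧
      ∃ ψ : BalEquiv (NormalFun (ProperArch A)) (BddFun (MaxLIdeal A)),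
        ∀ f : NormalFun (ProperArch A), ψ.toAlgEquiv f = restrictMax f.val) ∧
    (∀ (f : BddFun (ProperArch A)) (I : ProperArch A),
      IsGLB {r : ℝ | ∃ M : MaxLIdeal A, I ≤ M.toProperArch ∧ r = f.1 M.toProperArch}
        ((normalization f).1 I)) := by
  refine ⟨⟨BalAlgebra.ofEquiv (restrictEquiv A), ?_, BalEquiv.ofEquiv (restrictEquiv A),
    fun _ => rfl⟩, isGLB_normalization⟩
  let _ := BalAlgebra.ofEquiv (restrictEquiv A)
  exact
    { le_iff := fun _ _ => restrictMax_le_iff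
      -- Each `rfl` says that restriction commutes with the pointwise operation, which holds by
      -- definition.
      sup_val := fun _ _ => restrictEquiv_symm_val rfl
      inf_val := fun _ _ => restrictEquiv_symm_val rfl
      zero_val := restrictEquiv_symm_val rfl
      one_val := restrictEquiv_symm_val rfl
      add_val := fun _ _ => restrictEquiv_symm_val rfl
      neg_val := fun _ => restrictEquiv_symm_val rfl
      mul_val := fun _ _ => restrictEquiv_symm_val rfl
      smul_val := fun _ _ => restrictEquiv_symm_val rfl }
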